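/- Let $n\ge 1$ be an integer. Let $\mathbb{Z}_2$ be the field with two elements. For an ideal $I$ of a commutative ring $R$, a reduction of $I$ is an ideal $J\subseteq I$ with $I^{m+1}=JI^m$ for some $m>0$; it is proper if $J\ne I$ and principal if it is generated by one element. The ideal $I$ is integrally closed if it contains every $x\in R$ satisfying an equation $x^m+a_1x^{m-1}+\cdots+a_m=0$ with $m\ge 1$ and $a_i\in I^i$ for $1\le i\le m$. There exist $2^n-1$ distinct maximal ideals of $\mathbb{Z}_2[x]$. For every choice of $2^n-1$ distinct maximal ideals $M_1,\dots,M_{2^n-1}$ of $\mathbb{Z}_2[x]$, let $S=\mathbb{Z}_2[x]\setminus(M_1\cup\cdots\cup M_{2^n-1})$, let $J$ be the Jacobson radical of the localization $\mathbb{Z}_2[x]_S$, and let $R=\mathbb{Z}_2+J\subseteq\mathbb{Z}_2[x]_S$. Then: 1. $R$ is a one-dimensional local Noetherian domain; 2. every integrally closed ideal of $R$ has a principal reduction; 3. $R$ has an ideal that is minimally generated by $n$ elements (it has a generating set of $n$ elements and none with fewer) and has no proper reduction. In particular, for each $n\ge 1$ there is a one-dimensional local Noetherian domain in which every integrally closed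 ideal has a principal reduction, but which has an ideal minimally generated by $n$ elements without a proper reduction. -/

import Mathlib

open Polynomial

/-- `J` is a reduction of `I`: `J ⊆ I` and `I ^ (m + 1) = J * I ^ m` for some `m > 0`. -/
def IsReductionOf {R : Type*} [CommRing R] (J I : Ideal R) : Prop :=
  J ≤ I ∧ ∃ m : ℕ, 0 < m ∧ I ^ (m + 1) = J * I ^ m

/-- `x` is integral over the ideal `I`: it satisfies an equation
`x ^ m + a₁ x ^ (m - 1) + ⋯ + aₘ = 0` with `m ≥ 1` and `aᵢ ∈ I ^ i`. -/
def IsIntegralOverIdeal {R : Type*} [CommRing R] (I : Ideal R) (x : R) : Prop :=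
  ∃ m : ℕ, 0 < m ∧ ∃ a : ℕ → R, (∀ i ∈ Finset.Icc 1 m, a i ∈ I ^ i) ∧
    x ^ m + ∑ i ∈ Finset.Icc 1 m, a i * x ^ (m - i) = 0

/-- `I` is an integrally closed ideal: it contains every element integral over it. -/
def IsIntegrallyClosedIdeal {R : Type*} [CommRing R] (I : Ideal R) : Prop :=
  ∀ x : R, IsIntegralOverIdeal I x → x ∈ I

/-- The complement of the union of the maximal ideals in `s`. -/
def unionCompl {A : Type*} [CommRing A] (s : Finset (MaximalSpectrum A)) : Submonoid A where
  carrier := {f | ∀ M ∈ s, f ∉ M.asIdeal}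
  one_mem' M _ := (Ideal.ne_top_iff_one _).mp M.isMaximal.ne_top
  mul_mem' hf hg M hM h :=
    (M.isMaximal.isPrime.mem_or_mem h).elim (hf M hM) (hg M hM)

/-- The subring `k + J` of a `k`-algebra `B`, where `J` is the Jacobson radical of `B`. -/
def scalarsAddJacobson (k B : Type*) [CommRing k] [CommRing B] [Algebra k B] :
    Subalgebra k B where
  carrier := {b | ∃ c : k, ∃ j ∈ (⊥ : Ideal B).jacobson, b = algebraMap k B c + j}
  add_mem' := by
    rintro _ _ ⟨c, j, hj, rfl⟩ ⟨d, l, hl, rfl⟩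
    exact ⟨c + d, j + l, add_mem hj hl, by rw [map_add]; ring⟩
  mul_mem' := by
    rintro _ _ ⟨c, j, hj, rfl⟩ ⟨d, l, hl, rfl⟩
    refine ⟨c * d, algebraMap k B c * l + (algebraMap k B d + l) * j,
      add_mem (Ideal.mul_mem_left _ _ hl) (Ideal.mul_mem_left _ _ hj), ?_⟩
    rw [map_mul]; ring
  algebraMap_mem' c := ⟨c, 0, zero_mem _, (add_zero _).symm⟩

/-- The ring `𝔽₂ + J`, where `J` is the Jacobson radical of the localization of `𝔽₂[x]` at the
complement of the union of the maximal ideals in `s`. -/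
abbrev SemilocalGluing (s : Finset (MaximalSpectrum (ZMod 2)[X])) : Type :=
  scalarsAddJacobson (ZMod 2) (Localization (unionCompl s))

/-! Write `B` for the localization, a semilocal PID with Jacobson radical `J ≠ 0`, and `R = k + J`
with `k = 𝔽₂`. Since `J` is an ideal of both rings, `R` is local with maximal ideal `m = J` and
residue field `k`, and `B` is finite over `R`. Finiteness of all proper quotients passes from `k[X]`
to `B` to `R` (`hasFiniteQuotients`), which makes `R` Noetherian of dimension one.

Every element of `IB ∩ R` is integral over `I`. If `I` is proper and integrally closed, then `IB ⊆ J
⊆ R` forces `I = IB = gB`, so `I² = gI` (`exists_principal_reduction`).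

For the other ideal, index the `2 ^ n - 1` maximal ideals by the nonzero `w ∈ kⁿ`, choose `b i ≡ w
i` modulo `M w` by the Chinese remainder theorem, and let `I` be generated by the `p * b i` with `0
≠ p ∈ J`. Then `I/mI ≅ kⁿ`, and every nonzero functional on it is pairing with some `w`, hence is
detected by `M w`. If `K + mI ≠ I`, some such functional kills `K`, so `KB ⊆ p (M w)`; then `I ^ (r
+ 1) = K I ^ r` would put every `b i` in `M w`, which is false. Nakayama gives `K = I` for every
reduction (`exists_ideal_without_proper_reduction`). -/

namespace ScalarsAddJacobson

/-! ### Ring structure of `k + J`: local, Noetherian, one-dimensional, with `B` finite over it. -/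

variable {k B : Type*} [Field k] [CommRing B] [Algebra k B]

/-- The ideal of `k + J` of elements lying in the Jacobson radical `J` of `B`. -/
def radIdeal (k B : Type*) [Field k] [CommRing B] [Algebra k B] :
    Ideal (scalarsAddJacobson k B) :=
  (⊥ : Ideal B).jacobson.comap (algebraMap (scalarsAddJacobson k B) B)

theorem mem_radIdeal {x : scalarsAddJacobson k B} :
    x ∈ radIdeal k B ↔ (x : B) ∈ (⊥ : Ideal B).jacobson := Iff.rfl

theorem mem_of_mem_jacobson {y : B} (hy : y ∈ (⊥ : Ideal B).jacobson) :
    y ∈ scalarsAddJacobson k B :=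
  ⟨0, y, hy, by simp⟩

theorem exists_sub_algebraMap_mem (x : scalarsAddJacobson k B) :
    ∃ c : k, x - algebraMap k _ c ∈ radIdeal k B := by
  obtain ⟨c, j, hj, h⟩ := x.2
  refine ⟨c, ?_⟩
  rw [mem_radIdeal]
  have : ((x - algebraMap k (scalarsAddJacobson k B) c : scalarsAddJacobson k B) : B) = j := by
    simp [h]
  rwa [this]

theorem isUnit_one_add {j : scalarsAddJacobson k B} (hj : j ∈ radIdeal k B) :
    IsUnit (1 + j) := by
  have h := Ideal.mem_jacobson_bot.mp (mem_radIdeal.mp hj) 1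
  obtain ⟨u, hu⟩ := h.exists_right_inv
  have hmem : -((j : B) * u) ∈ (⊥ : Ideal B).jacobson :=
    neg_mem (Ideal.mul_mem_right _ _ (mem_radIdeal.mp hj))
  -- The inverse `u` of `1 + j` in `B` equals `1 - j * u`, which already lies in `k + J`.
  refine IsUnit.of_mul_eq_one (1 + ⟨_, mem_of_mem_jacobson hmem⟩) (Subtype.ext ?_)
  push_cast
  linear_combination -(j : B) * hu

theorem radIdeal_ne_top [Nontrivial B] : radIdeal k B ≠ ⊤ := by
  rw [Ne, Ideal.eq_top_iff_one, mem_radIdeal]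
  intro h
  have := Ideal.mem_jacobson_bot.mp h (-1)
  simp at this

theorem isUnit_of_notMem {x : scalarsAddJacobson k B} (hx : x ∉ radIdeal k B) : IsUnit x := by
  obtain ⟨c, hc⟩ := exists_sub_algebraMap_mem x
  have hc0 : c ≠ 0 := by
    rintro rfl
    simp [hx] at hc
  have hu : IsUnit (algebraMap k (scalarsAddJacobson k B) c) := (IsUnit.mk0 c hc0).map _
  have h1 := hu.mul (isUnit_one_add
    (Ideal.mul_mem_left _ (algebraMap k (scalarsAddJacobson k B) c⁻¹) hc))
  convert h1 using 1
  rw [mul_add, ← mul_assoc, ← map_mul, mul_inv_cancel₀ hc0]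
  simp

theorem le_radIdeal {I : Ideal (scalarsAddJacobson k B)} (hI : I ≠ ⊤) : I ≤ radIdeal k B := by
  intro x hx
  by_contra h
  exact hI (Ideal.eq_top_of_isUnit_mem _ hx (isUnit_of_notMem h))

variable (k B) in
theorem isLocalRing [Nontrivial B] : IsLocalRing (scalarsAddJacobson k B) := by
  refine .of_isUnit_or_isUnit_one_sub_self fun a ↦ or_iff_not_imp_left.mpr fun ha ↦ ?_
  have ha' : a ∈ radIdeal k B := by_contra fun h ↦ ha (isUnit_of_notMem h)
  simpa [sub_eq_add_neg] using isUnit_one_add (neg_mem ha')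

theorem radIdeal_le_jacobson : radIdeal k B ≤ (⊥ : Ideal (scalarsAddJacobson k B)).jacobson := by
  intro x hx
  rw [Ideal.mem_jacobson_bot]
  intro y
  rw [add_comm]
  exact isUnit_one_add (Ideal.mul_mem_right _ _ hx)

theorem radIdeal_ne_bot (hJ : (⊥ : Ideal B).jacobson ≠ ⊥) : radIdeal k B ≠ ⊥ := by
  obtain ⟨p, hp, hp0⟩ := Submodule.exists_mem_ne_zero_of_ne_bot hJ
  intro h
  have : (⟨p, mem_of_mem_jacobson hp⟩ : scalarsAddJacobson k B) ∈ radIdeal k B := hp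
  rw [h, Ideal.mem_bot] at this
  exact hp0 (congrArg Subtype.val this)

-- For nonzero `f ∈ I` and `p ∈ J`, the set `f p B` lies in `f (k + J)` because `p B ⊆ J`. Hence the
-- quotient by `I` is a quotient of a subring of the finite ring `B / f p B`. Noetherianity and
-- maximality of nonzero primes both follow from finite quotients.
variable (k) in
theorem hasFiniteQuotients [IsDomain B] [Ring.HasFiniteQuotients B]
    (hJ : (⊥ : Ideal B).jacobson ≠ ⊥) :
    Ring.HasFiniteQuotients (scalarsAddJacobson k B) where
  finiteQuotient {I} hI := by
    obtain ⟨f, hf, hf0⟩ := Submodule.exists_mem_ne_zero_of_ne_bot hI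
    obtain ⟨p, hp, hp0⟩ := Submodule.exists_mem_ne_zero_of_ne_bot hJ
    have hf0' : (f : B) ≠ 0 := fun h ↦ hf0 (Subtype.ext h)
    have : Finite (B ⧸ Ideal.span {(f : B) * p}) :=
      Ring.HasFiniteQuotients.finiteQuotient (by simp [hf0', hp0])
    let φ : scalarsAddJacobson k B →+* B ⧸ Ideal.span {(f : B) * p} :=
      (Ideal.Quotient.mk _).comp (algebraMap (scalarsAddJacobson k B) B)
    have : Finite (scalarsAddJacobson k B ⧸ RingHom.ker φ) :=
      Finite.of_injective _ (RingHom.kerLift_injective φ)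
    have hle : RingHom.ker φ ≤ I := by
      intro x hx
      have hx : (x : B) ∈ Ideal.span {(f : B) * p} := Ideal.Quotient.eq_zero_iff_mem.mp hx
      obtain ⟨b, hb⟩ := Ideal.mem_span_singleton'.mp hx
      have hbp : b * p ∈ scalarsAddJacobson k B :=
        mem_of_mem_jacobson (Ideal.mul_mem_left _ _ hp)
      have : x = ⟨b * p, hbp⟩ * f := Subtype.ext (by simp [← hb]; ring)
      rw [this]
      exact Ideal.mul_mem_left _ _ hf
    exact Finite.of_surjective _ (Ideal.Quotient.factor_surjective hle)

variable (k) in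
theorem ringKrullDim_eq_one [IsDomain B] [Ring.HasFiniteQuotients B]
    (hJ : (⊥ : Ideal B).jacobson ≠ ⊥) : ringKrullDim (scalarsAddJacobson k B) = 1 := by
  have := isLocalRing k B
  have := hasFiniteQuotients k hJ
  refine ringKrullDim_eq_one_iff_of_isLocalRing_isDomain.mpr ⟨fun h ↦ ?_, fun x hx ↦ ?_⟩
  · obtain ⟨p, hp, hp0⟩ := Submodule.exists_mem_ne_zero_of_ne_bot (radIdeal_ne_bot (k := k) hJ)
    obtain ⟨q, hq⟩ := h.mul_inv_cancel hp0
    exact radIdeal_ne_top (k := k) (B := B)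
      ((Ideal.eq_top_iff_one _).mpr (hq ▸ Ideal.mul_mem_right _ _ hp))
  · rw [Ideal.radical_eq_sInf]
    refine le_sInf fun P ⟨hxP, hP⟩ ↦ ?_
    have : P.IsMaximal := Ring.HasFiniteQuotients.maximalOfPrime fun h ↦ hx (by
      simpa [h] using hxP (Ideal.mem_span_singleton_self x))
    exact (IsLocalRing.eq_maximalIdeal this).ge

variable (k) in
theorem moduleFinite [Ring.HasFiniteQuotients B]
    (hJ : (⊥ : Ideal B).jacobson ≠ ⊥) : Module.Finite (scalarsAddJacobson k B) B := by
  have : Finite (B ⧸ (⊥ : Ideal B).jacobson) := Ring.HasFiniteQuotients.finiteQuotient hJ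
  -- Representatives of the finite ring `B / J` generate `B` together with `1`, since `J` is
  -- contained in `(k + J) • 1`.
  let t : Set B := insert 1 (Set.range (Quotient.out : B ⧸ (⊥ : Ideal B).jacobson → B))
  refine ⟨Submodule.fg_def.mpr ⟨t, (Set.finite_range _).insert 1, eq_top_iff.mpr fun b _ ↦ ?_⟩⟩
  let c : B := Quotient.out (Ideal.Quotient.mk (⊥ : Ideal B).jacobson b)
  have hc : b - c ∈ (⊥ : Ideal B).jacobson := by
    rw [← Ideal.Quotient.mk_eq_mk_iff_sub_mem]
    exact (Quotient.out_eq _).symm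
  have hb : b = c + (⟨b - c, mem_of_mem_jacobson hc⟩ : scalarsAddJacobson k B) • (1 : B) := by
    simp [Subalgebra.smul_def]
  rw [hb]
  exact add_mem (Submodule.subset_span (Set.mem_insert_of_mem _ ⟨_, rfl⟩))
    (Submodule.smul_mem _ _ (Submodule.subset_span (Set.mem_insert _ _)))

end ScalarsAddJacobson

/-! ### Integrality over ideals and reductions in general. -/

theorem isIntegralOverIdeal_of_algebraMap_mem_map {R S : Type*} [CommRing R] [CommRing S]
    [Algebra R S] [Module.Finite R S] [Nontrivial R] (hinj : Function.Injective (algebraMap R S))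
    {I : Ideal R} {x : R} (hx : algebraMap R S x ∈ I.map (algebraMap R S)) :
    IsIntegralOverIdeal I x := by
  -- Determinant trick: multiplication by `x` maps the finite module `S` into `I S`, so
  -- Cayley–Hamilton gives a monic `q` whose coefficient of degree `deg q - i` lies in `I ^ i`.
  obtain ⟨q, hq, -, hcoeff, hzero⟩ :=
    LinearMap.exists_monic_and_natDegree_eq_and_coeff_mem_pow_and_aeval_eq_zero R
      (Algebra.lmul R S (algebraMap R S x)) I (by
        rintro _ ⟨y, rfl⟩
        rw [Ideal.smul_top_eq_map]
        exact Ideal.mul_mem_right _ _ hx)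
  have heval : q.eval x = 0 := by
    apply hinj
    rw [Polynomial.aeval_algHom_apply] at hzero
    have h := Algebra.lmul_injective (R := R) (hzero.trans (map_zero _).symm)
    rwa [Polynomial.aeval_algebraMap_apply, ← map_zero (algebraMap R S),
      Polynomial.coe_aeval_eq_eval] at h
  have hdeg : 0 < q.natDegree := by
    refine Nat.pos_of_ne_zero fun h ↦ ?_
    rw [hq.natDegree_eq_zero.mp h] at heval
    simp at heval
  refine ⟨q.natDegree, hdeg, fun i ↦ q.coeff (q.natDegree - i), fun i hi ↦ ?_, ?_⟩
  · have hi := (Finset.mem_Icc.mp hi).2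
    have := hcoeff (q.natDegree - i)
    rwa [Nat.sub_sub_self hi] at this
  · rw [← heval, Polynomial.eval_eq_sum_range, Finset.sum_range_succ, hq.coeff_natDegree, one_mul,
      add_comm, add_left_inj]
    refine Finset.sum_nbij' (fun i ↦ q.natDegree - i) (fun i ↦ q.natDegree - i) ?_ ?_ ?_ ?_ ?_
    all_goals simp only [Finset.mem_Icc, Finset.mem_range]
    all_goals intros
    all_goals first | omega | trivial

theorem isReductionOf_refl {R : Type*} [CommRing R] (I : Ideal R) : IsReductionOf I I :=
  ⟨le_rfl, 1, one_pos, pow_succ' I 1⟩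

/-! ### Reductions of ideals of `k + J`. -/

namespace ScalarsAddJacobson

variable {k B : Type*} [Field k] [CommRing B] [Algebra k B]

theorem exists_principal_reduction [IsDomain B] [IsPrincipalIdealRing B]
    [Ring.HasFiniteQuotients B] (hJ : (⊥ : Ideal B).jacobson ≠ ⊥)
    {I : Ideal (scalarsAddJacobson k B)} (hI : IsIntegrallyClosedIdeal I) :
    ∃ a : scalarsAddJacobson k B, IsReductionOf (Ideal.span {a}) I := by
  by_cases htop : I = ⊤
  · exact ⟨1, by rw [htop, Ideal.span_singleton_one]; exact isReductionOf_refl _⟩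
  have := moduleFinite k hJ
  obtain ⟨g, hg⟩ := (IsPrincipalIdealRing.principal
    (I.map (algebraMap (scalarsAddJacobson k B) B))).principal
  have hmap : I.map (algebraMap (scalarsAddJacobson k B) B) ≤ (⊥ : Ideal B).jacobson :=
    Ideal.map_le_iff_le_comap.mpr (le_radIdeal htop)
  -- This is `IB = I`: elements of `IB` lie in `J`, hence in `k + J`, and are integral over `I`.
  have hmem (y : B) (hy : y ∈ I.map (algebraMap (scalarsAddJacobson k B) B)) :
      ∃ h : y ∈ scalarsAddJacobson k B, (⟨y, h⟩ : scalarsAddJacobson k B) ∈ I :=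
    ⟨mem_of_mem_jacobson (hmap hy), hI _ (isIntegralOverIdeal_of_algebraMap_mem_map
      (S := B) Subtype.val_injective hy)⟩
  have hgI : g ∈ I.map (algebraMap (scalarsAddJacobson k B) B) :=
    hg ▸ Submodule.mem_span_singleton_self g
  obtain ⟨hgR, hg'⟩ := hmem g hgI
  have hle : Ideal.span {(⟨g, hgR⟩ : scalarsAddJacobson k B)} ≤ I :=
    (Ideal.span_singleton_le_iff_mem _).mpr hg'
  refine ⟨⟨g, hgR⟩, hle, 1, one_pos, le_antisymm ?_ ?_⟩
  · rw [pow_two, pow_one, Ideal.mul_le]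
    intro x hx y hy
    have h1 := Ideal.mem_map_of_mem (algebraMap (scalarsAddJacobson k B) B) hx
    have h2 := Ideal.mem_map_of_mem (algebraMap (scalarsAddJacobson k B) B) hy
    rw [hg] at h1
    obtain ⟨b, hb⟩ := Ideal.mem_span_singleton'.mp h1
    -- With `x = b * g`, the product `x * y` is `g * (b * y)`, and `b * y ∈ IB = I`.
    obtain ⟨h3, h4⟩ := hmem _ (Ideal.mul_mem_left _ b h2)
    have : x * y = ⟨g, hgR⟩ * ⟨_, h3⟩ := Subtype.ext (by
      change (x : B) * y = g * (b * y)
      rw [show (x : B) = b * g from hb.symm]; ring)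
    rw [this]
    exact Ideal.mul_mem_mul (Ideal.mem_span_singleton_self _) h4
  · rw [pow_two, pow_one]
    exact Ideal.mul_mono_left hle

/-- Because `k` is the residue field, generators of `I` span `I / mI` over `k`; a family independent
there is no larger than any generating set. -/
theorem finrank_le_spanFinrank {ι : Type*} [Fintype ι]
    {I : Ideal (scalarsAddJacobson k B)} (hfg : I.FG) (g : ι → scalarsAddJacobson k B)
    (hgI : ∀ i, g i ∈ I)
    (hg : ∀ c : ι → k, ∑ i, c i • g i ∈ radIdeal k B * I → c = 0) :
    Fintype.card ι ≤ Submodule.spanFinrank I := by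
  classical
  obtain ⟨t, ht, htI⟩ := Submodule.FG.exists_span_finset_card_eq_spanFinrank hfg
  rw [← ht]
  let Q := scalarsAddJacobson k B ⧸ (radIdeal k B * I)
  let π : scalarsAddJacobson k B →ₗ[k] Q :=
    (Ideal.Quotient.mkₐ k (radIdeal k B * I)).toLinearMap
  have hker (x : scalarsAddJacobson k B) : π x = 0 ↔ x ∈ radIdeal k B * I :=
    Ideal.Quotient.eq_zero_iff_mem
  have hli : LinearIndependent k (fun i ↦ π (g i)) := by
    rw [Fintype.linearIndependent_iff]
    intro c hc i
    simp only [← map_smul, ← map_sum, hker] at hc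
    exact congrFun (hg c hc) i
  have hspan (x : scalarsAddJacobson k B) (hx : x ∈ I) :
      π x ∈ Submodule.span k (↑(t.image π) : Set Q) := by
    rw [← htI] at hx
    induction hx using Submodule.span_induction with
    | mem x hx =>
      exact Submodule.subset_span (Finset.mem_coe.mpr (Finset.mem_image_of_mem π hx))
    | zero => simp
    | add x y _ _ hx hy => rw [map_add]; exact add_mem hx hy
    | smul a x hx ih =>
      obtain ⟨c, hc⟩ := exists_sub_algebraMap_mem a
      have h0 : π ((a - algebraMap k _ c) * x) = 0 :=
        (hker _).mpr (Ideal.mul_mem_mul hc (htI ▸ hx))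
      have : a • x = c • x + (a - algebraMap k _ c) * x := by
        rw [smul_eq_mul, Algebra.smul_def]; ring
      rw [this, map_add, h0, add_zero, map_smul]
      exact Submodule.smul_mem _ _ ih
  calc Fintype.card ι = Module.finrank k (Submodule.span k (Set.range fun i ↦ π (g i))) :=
        (finrank_span_eq_card hli).symm
    _ ≤ Module.finrank k (Submodule.span k (↑(t.image π) : Set Q)) :=
        Submodule.finrank_mono (Submodule.span_le.mpr (by
          rintro _ ⟨i, rfl⟩
          exact hspan _ (hgI i)))
    _ ≤ (t.image π).card := finrank_span_finset_le_card _
    _ ≤ t.card := Finset.card_image_le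

/-- If `B` has a nonzero Jacobson radical and, for each nonzero `w : Fin n → k`, a proper prime
`M w` containing it, such that some `b i : B` have residue `w i` modulo `M w`, then `k + J` has an
ideal minimally generated by `n` elements without a proper reduction. -/
theorem exists_ideal_without_proper_reduction [IsDomain B]
    (hJ : (⊥ : Ideal B).jacobson ≠ ⊥) {n : ℕ} (M : (Fin n → k) → Ideal B)
    (hprime : ∀ w, w ≠ 0 → (M w).IsPrime) (hM : ∀ w, w ≠ 0 → (⊥ : Ideal B).jacobson ≤ M w)
    (b : Fin n → B) (hb : ∀ w, w ≠ 0 → ∀ i, b i - algebraMap k B (w i) ∈ M w) :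
    ∃ I : Ideal (scalarsAddJacobson k B), Submodule.spanFinrank I = n ∧
      ∀ K : Ideal (scalarsAddJacobson k B), IsReductionOf K I → K = I := by
  obtain ⟨p, hp, hp0⟩ := Submodule.exists_mem_ne_zero_of_ne_bot hJ
  let g (i : Fin n) : scalarsAddJacobson k B :=
    ⟨p * b i, mem_of_mem_jacobson (Ideal.mul_mem_right _ _ hp)⟩
  let I : Ideal (scalarsAddJacobson k B) := Ideal.span (Set.range g)
  have hgI (i : Fin n) : g i ∈ I := Ideal.subset_span ⟨i, rfl⟩
  have hfg : I.FG := Submodule.fg_def.mpr ⟨_, Set.finite_range g, rfl⟩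
  have hIp : I.map (algebraMap (scalarsAddJacobson k B) B) ≤ Ideal.span {p} := by
    rw [Ideal.map_le_iff_le_comap, Ideal.span_le]
    rintro _ ⟨i, rfl⟩
    exact Ideal.mul_mem_right _ _ (Ideal.mem_span_singleton_self p)
  have hradI {w : Fin n → k} (hw : w ≠ 0) {x : scalarsAddJacobson k B}
      (hx : x ∈ radIdeal k B * I) : (x : B) ∈ Ideal.span {p} * M w := by
    have := Ideal.mem_map_of_mem (algebraMap (scalarsAddJacobson k B) B) hx
    rw [Ideal.map_mul, mul_comm] at this
    exact Ideal.mul_mono hIp ((Ideal.map_le_iff_le_comap.mpr le_rfl).trans (hM w hw)) this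
  -- After cancelling `p`, the combination `∑ c i • b i` has residue `∑ c i * w i` modulo `M w`, and
  -- a scalar in a proper ideal is zero.
  have hsum (c : Fin n → k) {w : Fin n → k} (hw : w ≠ 0) :
      ((∑ i, c i • g i : scalarsAddJacobson k B) : B) ∈ Ideal.span {p} * M w ↔
        ∑ i, c i * w i = 0 := by
    have h1 : ((∑ i, c i • g i : scalarsAddJacobson k B) : B) = p * ∑ i, c i • b i := by
      simp [g, Finset.mul_sum]
    have h2 : ∑ i, c i • b i - algebraMap k B (∑ i, c i * w i) ∈ M w := by
      rw [map_sum, ← Finset.sum_sub_distrib]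
      refine sum_mem fun i _ ↦ ?_
      rw [map_mul, Algebra.smul_def, ← mul_sub]
      exact Ideal.mul_mem_left _ _ (hb w hw i)
    rw [h1, Ideal.mem_span_singleton_mul]
    constructor
    · rintro ⟨z, hz, h⟩
      rw [mul_left_cancel₀ hp0 h] at hz
      have h3 := sub_mem hz h2
      rw [sub_sub_cancel] at h3
      by_contra h0
      exact (hprime w hw).ne_top
        (Ideal.eq_top_of_isUnit_mem _ h3 ((IsUnit.mk0 _ h0).map _))
    · intro h0
      rw [h0, map_zero, sub_zero] at h2
      exact ⟨_, h2, rfl⟩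
  refine ⟨I, le_antisymm ?_ ?_, fun K hK ↦ le_antisymm hK.1 ?_⟩
  · refine (Submodule.spanFinrank_span_le_ncard_of_finite (Set.finite_range g)).trans ?_
    rw [← Set.image_univ]
    exact (Set.ncard_image_le Set.finite_univ).trans (by simp [Set.ncard_univ])
  · simpa using finrank_le_spanFinrank hfg g hgI fun c hc ↦ by
      by_contra hc0
      obtain ⟨i, hi⟩ := Function.ne_iff.mp hc0
      -- Testing against the prime indexed by the `i`-th unit vector isolates the coordinate `c i`.
      have hw : (Pi.single i 1 : Fin n → k) ≠ 0 := by simp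
      have := (hsum c hw).mp (hradI hw hc)
      simp [Pi.single_apply] at this
      exact hi this
  -- By Nakayama it suffices that `I ≤ K + mI`. Below, `W` consists of the coefficient vectors whose
  -- combination of the `g i` lies in `K + mI`.
  · refine Submodule.le_of_le_smul_of_le_jacobson_bot hfg radIdeal_le_jacobson ?_
    let ψ : (Fin n → k) →ₗ[k] scalarsAddJacobson k B := Fintype.linearCombination k g
    have hψ (c : Fin n → k) : ψ c = ∑ i, c i • g i := Fintype.linearCombination_apply ..
    let L : Ideal (scalarsAddJacobson k B) := K ⊔ radIdeal k B • I
    let W : Submodule k (Fin n → k) := (L.restrictScalars k).comap ψ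
    by_cases hW : W = ⊤
    · refine Ideal.span_le.mpr ?_
      rintro _ ⟨i, rfl⟩
      have : Pi.single i 1 ∈ W := hW ▸ Submodule.mem_top
      have : ψ (Pi.single i 1) ∈ L := this
      rwa [hψ, Finset.sum_eq_single i (by simp +contextual) (by simp),
        Pi.single_eq_same, one_smul] at this
    exfalso
    -- A proper subspace lies in the kernel of a nonzero functional; its coordinates `w` select the
    -- prime `M w`.
    obtain ⟨f, hf0, hf⟩ := W.exists_le_ker_of_lt_top (lt_top_iff_ne_top.mpr hW)
    let w : Fin n → k := fun i ↦ f (Pi.single i 1)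
    have hfw (c : Fin n → k) : f c = ∑ i, c i * w i := by
      rw [LinearMap.pi_apply_eq_sum_univ f c]
      simp only [smul_eq_mul, w]
      congr! with i _ j
      simp [Pi.single_apply, eq_comm]
    have hw : w ≠ 0 := fun h ↦ hf0 (LinearMap.ext fun c ↦ by simp [hfw, h])
    have hKM : K.map (algebraMap (scalarsAddJacobson k B) B) ≤ Ideal.span {p} * M w := by
      rw [Ideal.map_le_iff_le_comap]
      intro x hx
      obtain ⟨r, hr⟩ := (Submodule.mem_span_range_iff_exists_fun _).mp (hK.1 hx)
      choose c hc using fun i ↦ exists_sub_algebraMap_mem (r i)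
      have hdiff : x - ψ c ∈ radIdeal k B * I := by
        rw [← hr, hψ, ← Finset.sum_sub_distrib]
        refine sum_mem fun i _ ↦ ?_
        rw [smul_eq_mul, Algebra.smul_def, ← sub_mul]
        exact Ideal.mul_mem_mul (hc i) (hgI i)
      have hcW : c ∈ W := by
        change ψ c ∈ L
        have := sub_mem (Submodule.mem_sup_left hx : x ∈ L)
          (Submodule.mem_sup_right hdiff : x - ψ c ∈ L)
        rwa [sub_sub_cancel] at this
      have h1 := (hsum c hw).mpr (by rw [← hfw]; exact hf hcW)
      have h2 := add_mem (hradI hw hdiff) h1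
      rw [← hψ] at h2
      simpa using h2
    obtain ⟨i, hi⟩ := Function.ne_iff.mp hw
    have hbi : b i ∉ M w := fun h ↦ (hprime w hw).ne_top
      (Ideal.eq_top_of_isUnit_mem _ (by simpa using sub_mem h (hb w hw i))
        ((IsUnit.mk0 _ hi).map (algebraMap k B)))
    -- Here `(p * b i) ^ (m + 1)` lies in `K I ^ m`, hence in `p ^ (m + 1) (M w)`. Cancelling the
    -- power of `p` puts `b i` in the prime `M w`.
    obtain ⟨m, -, hm⟩ := hK.2
    have h1 := Ideal.mem_map_of_mem (algebraMap (scalarsAddJacobson k B) B)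
      (hm ▸ Ideal.pow_mem_pow (hgI i) (m + 1))
    rw [Ideal.map_mul, Ideal.map_pow] at h1
    have h2 := Ideal.mul_mono hKM (Ideal.pow_right_mono hIp m) h1
    rw [mul_right_comm, ← pow_succ', Ideal.span_singleton_pow, Ideal.mem_span_singleton_mul] at h2
    obtain ⟨z, hz, h⟩ := h2
    have h3 : algebraMap (scalarsAddJacobson k B) B (g i ^ (m + 1)) = p ^ (m + 1) * b i ^ (m + 1) :=
      (map_pow _ _ _).trans (mul_pow _ _ _)
    rw [h3] at h
    rw [mul_left_cancel₀ (pow_ne_zero _ hp0) h] at hz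
    exact hbi ((hprime w hw).mem_of_pow_mem _ hz)

end ScalarsAddJacobson

/-! ### Localization at the complement of finitely many maximal ideals. -/

section Localization

variable {A : Type*} [CommRing A]

theorem isPrincipalIdealRing_of_isLocalization [IsPrincipalIdealRing A] (S : Submonoid A)
    (B : Type*) [CommRing B] [Algebra A B] [IsLocalization S B] : IsPrincipalIdealRing B where
  principal I := by
    obtain ⟨a, ha⟩ := (IsPrincipalIdealRing.principal (I.under A)).principal
    refine ⟨algebraMap A B a, ?_⟩
    rw [← IsLocalization.map_under S B I, ha, Ideal.submodule_span_eq, Ideal.map_span,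
      Set.image_singleton, Ideal.submodule_span_eq]

theorem hasFiniteQuotients_of_isLocalization [Ring.HasFiniteQuotients A] (S : Submonoid A)
    (B : Type*) [CommRing B] [Algebra A B] [IsLocalization S B] : Ring.HasFiniteQuotients B where
  finiteQuotient {I} hI := by
    have hne : I.under A ≠ ⊥ := fun h ↦ hI (by rw [← IsLocalization.map_under S B I, h]; simp)
    have : Finite (A ⧸ I.under A) := Ring.HasFiniteQuotients.finiteQuotient hne
    let φ : A ⧸ I.under A →+* B ⧸ I :=
      Ideal.quotientMap I (algebraMap A B) le_rfl
    refine Finite.of_surjective φ fun y ↦ ?_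
    obtain ⟨y, rfl⟩ := Ideal.Quotient.mk_surjective y
    obtain ⟨a, s, rfl⟩ := IsLocalization.exists_mk'_eq S y
    -- A denominator `s` acts injectively on the finite ring `A / (I ∩ A)`, hence surjectively, so
    -- `a / s` is congruent modulo `I` to an element of `A`.
    have hinj : Function.Injective
        (fun z : A ⧸ I.under A ↦ Ideal.Quotient.mk (I.under A) (s : A) * z) := by
      refine (injective_iff_map_eq_zero (AddMonoidHom.mulLeft
        (Ideal.Quotient.mk (I.under A) (s : A)))).mpr fun z hz ↦ ?_
      obtain ⟨z, rfl⟩ := Ideal.Quotient.mk_surjective z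
      rw [AddMonoidHom.coe_mulLeft, ← map_mul, Ideal.Quotient.eq_zero_iff_mem, Ideal.mem_comap,
        map_mul, Ideal.unit_mul_mem_iff_mem _ (IsLocalization.map_units B s)] at hz
      exact Ideal.Quotient.eq_zero_iff_mem.mpr hz
    obtain ⟨z, hz⟩ := Finite.injective_iff_surjective.mp hinj (Ideal.Quotient.mk _ a)
    obtain ⟨z, rfl⟩ := Ideal.Quotient.mk_surjective z
    refine ⟨Ideal.Quotient.mk _ z, ?_⟩
    beta_reduce at hz
    rw [← map_mul, Ideal.Quotient.mk_eq_mk_iff_sub_mem, Ideal.mem_comap] at hz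
    change Ideal.Quotient.mk I (algebraMap A B z) = _
    rw [Ideal.Quotient.mk_eq_mk_iff_sub_mem,
      ← Ideal.unit_mul_mem_iff_mem _ (IsLocalization.map_units B s), mul_sub,
      IsLocalization.mk'_spec', ← map_mul, ← map_sub]
    exact hz

theorem exists_ne_zero_forall_mem [IsDomain A] (hA : ¬ IsField A)
    (s : Finset (MaximalSpectrum A)) : ∃ q : A, q ≠ 0 ∧ ∀ M ∈ s, q ∈ M.asIdeal := by
  have hne : ∏ M ∈ s, M.asIdeal ≠ ⊥ := Finset.prod_ne_zero_iff.mpr fun M _ ↦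
    Ring.ne_bot_of_isMaximal_of_not_isField M.isMaximal hA
  obtain ⟨q, hq, hq0⟩ := Submodule.exists_mem_ne_zero_of_ne_bot hne
  exact ⟨q, hq0, fun M hM ↦ Finset.inf_le (f := MaximalSpectrum.asIdeal) hM
    (Ideal.prod_le_inf hq)⟩

/-- Finitely many nonzero maximal ideals would have a nonzero common element, which would lie in the
Jacobson radical. -/
theorem infinite_maximalSpectrum [IsDomain A] (hA : ¬ IsField A)
    (hjac : (⊥ : Ideal A).jacobson = ⊥) : Infinite (MaximalSpectrum A) := by
  refine not_finite_iff_infinite.mp fun hfin ↦ ?_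
  have := Fintype.ofFinite (MaximalSpectrum A)
  obtain ⟨q, hq0, hq⟩ := exists_ne_zero_forall_mem hA Finset.univ
  refine hq0 (Ideal.mem_bot.mp (hjac ▸ Ideal.mem_sInf.mpr fun {M} hM ↦ ?_))
  exact hq ⟨M, hM.2⟩ (Finset.mem_univ _)

variable {s : Finset (MaximalSpectrum A)}

theorem unionCompl_le_nonZeroDivisors [IsDomain A] (hs : s.Nonempty) :
    unionCompl s ≤ nonZeroDivisors A := by
  obtain ⟨M, hM⟩ := hs
  refine le_nonZeroDivisors_of_noZeroDivisors fun h ↦ h M hM (zero_mem _)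

theorem disjoint_unionCompl {M : MaximalSpectrum A} (hM : M ∈ s) :
    Disjoint (unionCompl s : Set A) (M.asIdeal : Set A) :=
  Set.disjoint_left.mpr fun _ hf ↦ hf M hM

theorem jacobson_localization_unionCompl_ne_bot [IsDomain A] (hA : ¬ IsField A)
    (hs : s.Nonempty) : (⊥ : Ideal (Localization (unionCompl s))).jacobson ≠ ⊥ := by
  obtain ⟨q, hq0, hq⟩ := exists_ne_zero_forall_mem hA s
  intro h
  have hmem : algebraMap A (Localization (unionCompl s)) q ∈
      (⊥ : Ideal (Localization (unionCompl s))).jacobson := by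
    rw [Ideal.mem_jacobson_bot]
    intro y
    obtain ⟨a, t, rfl⟩ := IsLocalization.exists_mk'_eq (unionCompl s) y
    -- As `q` lies in every `M ∈ s`, adding a multiple of it to `t` keeps the sum outside each `M`.
    have hu : q * a + t ∈ unionCompl s := fun M hM h ↦
      t.2 M hM ((Ideal.add_mem_iff_right _ (Ideal.mul_mem_right _ _ (hq M hM))).mp h)
    have h1 := IsLocalization.map_units (Localization (unionCompl s)) (⟨_, hu⟩ : unionCompl s)
    refine isUnit_of_mul_isUnit_right (x := algebraMap A _ (t : A)) ?_
    convert h1 using 1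
    rw [mul_add, mul_left_comm, IsLocalization.mk'_spec', mul_one, ← map_mul, ← map_add]
  rw [h, Ideal.mem_bot] at hmem
  exact hq0 (IsLocalization.injective _ (unionCompl_le_nonZeroDivisors hs)
    (hmem.trans (map_zero _).symm))

theorem isPrime_map_unionCompl {M : MaximalSpectrum A} (hM : M ∈ s) :
    (M.asIdeal.map (algebraMap A (Localization (unionCompl s)))).IsPrime :=
  IsLocalization.isPrime_of_isPrime_disjoint _ _ _ M.isMaximal.isPrime (disjoint_unionCompl hM)

theorem jacobson_le_map_unionCompl {M : MaximalSpectrum A} (hM : M ∈ s) :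
    (⊥ : Ideal (Localization (unionCompl s))).jacobson ≤
      M.asIdeal.map (algebraMap A (Localization (unionCompl s))) := by
  intro y hy
  obtain ⟨a, t, rfl⟩ := IsLocalization.exists_mk'_eq (unionCompl s) y
  rw [IsLocalization.mk'_mem_iff] at hy ⊢
  refine Ideal.mem_map_of_mem _ (by_contra fun ha ↦ ?_)
  -- If `a ∉ M`, then `1 - c * a` lies in `M` for some `c`; it would be a unit because `a` maps into
  -- the Jacobson radical, but `M` extends to a proper ideal.
  obtain ⟨c, hc⟩ := M.isMaximal.exists_inv ha
  obtain ⟨i, hi, hci⟩ := hc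
  have hu := Ideal.mem_jacobson_bot.mp hy (-algebraMap A _ c)
  refine (isPrime_map_unionCompl hM).ne_top (Ideal.eq_top_of_isUnit_mem _ ?_ hu)
  have h : algebraMap A (Localization (unionCompl s)) i =
      algebraMap A _ a * -algebraMap A _ c + 1 := by
    rw [← map_one (algebraMap A (Localization (unionCompl s))), ← hci]
    simp only [map_add, map_mul]
    ring
  rw [← h]
  exact Ideal.mem_map_of_mem _ hi

end Localization

/-! ### Polynomials over a field, and the assembly. -/

theorem hasFiniteQuotients_polynomial (k : Type*) [Field k] [Finite k] :
    Ring.HasFiniteQuotients k[X] where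
  finiteQuotient {I} hI := by
    obtain ⟨f, hf, hf0⟩ := Submodule.exists_mem_ne_zero_of_ne_bot hI
    have hfin : Module.Finite k (AdjoinRoot f) := (AdjoinRoot.powerBasis hf0).finite
    have : Finite (k[X] ⧸ Ideal.span {f}) := Module.finite_of_finite k (M := AdjoinRoot f)
    exact Finite.of_surjective _
      (Ideal.Quotient.factor_surjective ((Ideal.span_singleton_le_iff_mem I).mpr hf))

theorem infinite_maximalSpectrum_polynomial (k : Type*) [Field k] :
    Infinite (MaximalSpectrum k[X]) :=
  infinite_maximalSpectrum (Polynomial.not_isField k)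
    (IsJacobsonRing.out inferInstance Ideal.isPrime_bot.isRadical)

theorem mainTheorem9 (n : ℕ) (hn : 1 ≤ n) :
    (∃ s : Finset (MaximalSpectrum (ZMod 2)[X]), s.card = 2 ^ n - 1) ∧
    ∀ s : Finset (MaximalSpectrum (ZMod 2)[X]), s.card = 2 ^ n - 1 →
      IsDomain (SemilocalGluing s) ∧
      IsNoetherianRing (SemilocalGluing s) ∧
      IsLocalRing (SemilocalGluing s) ∧
      ringKrullDim (SemilocalGluing s) = 1 ∧
      (∀ I : Ideal (SemilocalGluing s), IsIntegrallyClosedIdeal I →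
        ∃ a : SemilocalGluing s, IsReductionOf (Ideal.span {a}) I) ∧
      (∃ I : Ideal (SemilocalGluing s), Submodule.spanFinrank I = n ∧
        ∀ J : Ideal (SemilocalGluing s), IsReductionOf J I → J = I) := by
  have := infinite_maximalSpectrum_polynomial (ZMod 2)
  refine ⟨Infinite.exists_subset_card_eq _ _, fun s hcard ↦ ?_⟩
  -- For `n = 0` the set `s` would be empty, `0` would be inverted, and the localization would be
  -- the zero ring.
  have hs : s.Nonempty := by
    rw [← Finset.card_pos, hcard]
    exact Nat.sub_pos_of_lt (Nat.one_lt_two_pow (by omega))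
  have hA : ¬ IsField (ZMod 2)[X] := Polynomial.not_isField _
  have := hasFiniteQuotients_polynomial (ZMod 2)
  have := IsLocalization.isDomain_localization (unionCompl_le_nonZeroDivisors hs)
  have := isPrincipalIdealRing_of_isLocalization (unionCompl s) (Localization (unionCompl s))
  have := hasFiniteQuotients_of_isLocalization (unionCompl s) (Localization (unionCompl s))
  have hJ := jacobson_localization_unionCompl_ne_bot hA hs
  have := ScalarsAddJacobson.hasFiniteQuotients (ZMod 2) hJ
  refine ⟨inferInstance, inferInstance, ScalarsAddJacobson.isLocalRing _ _,
    ScalarsAddJacobson.ringKrullDim_eq_one _ hJ,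
    fun I hI ↦ ScalarsAddJacobson.exists_principal_reduction hJ hI, ?_⟩
  have hcard' : Fintype.card {w : Fin n → ZMod 2 // w ≠ 0} = Fintype.card s := by
    rw [Fintype.card_subtype_compl, Fintype.card_coe, hcard]
    simp
  let e : {w : Fin n → ZMod 2 // w ≠ 0} ≃ s := Fintype.equivOfCardEq hcard'
  have hcop : Pairwise (Function.onFun IsCoprime fun M : s ↦ M.1.asIdeal) := fun M N h ↦
    MaximalSpectrum.isCoprime_of_ne (Subtype.coe_injective.ne h)
  -- Chinese remainder theorem: `b i` is congruent to the constant `w i` modulo the maximal ideal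
  -- labelled `w`.
  choose b hb using fun i ↦
    Ideal.exists_forall_sub_mem_ideal hcop fun M ↦ C ((e.symm M).1 i)
  refine ScalarsAddJacobson.exists_ideal_without_proper_reduction hJ
    (fun w ↦ if hw : w ≠ 0 then
      (e ⟨w, hw⟩).1.asIdeal.map (algebraMap _ (Localization (unionCompl s))) else ⊤)
    (fun w hw ↦ ?_) (fun w hw ↦ ?_) (fun i ↦ algebraMap _ _ (b i)) fun w hw i ↦ ?_
  · rw [dif_pos hw]
    exact isPrime_map_unionCompl (e ⟨w, hw⟩).2
  · rw [dif_pos hw]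
    exact jacobson_le_map_unionCompl (e ⟨w, hw⟩).2
  · rw [dif_pos hw, IsScalarTower.algebraMap_apply (ZMod 2) (ZMod 2)[X], ← map_sub]
    refine Ideal.mem_map_of_mem _ ?_
    simpa using hb i (e ⟨w, hw⟩)
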